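/- Let $m,n,s,r$ be non-negative integers with $r\le s\le n$, let $F\in\mathbb{R}^{m\times n}$ be a matrix with $\operatorname{rank}(F)=r$, and let $X\in\mathbb{R}^{n\times s}$ be a matrix with linearly independent columns such that $\operatorname{rank}(FX)=r$. Let $\mathcal{G}_{n,r}$ denote the Grassmann manifold of $r$-dimensional linear subspaces of $\mathbb{R}^n$, with its standard smooth structure. Then the set $$\mathcal{V}_X=\left\{\operatorname{Range}\big(\tilde F^T\big)\ :\ \tilde F\in\mathbb{R}^{m\times n},\ \operatorname{rank}(\tilde F)=r,\ \tilde F X=FX\right\}\subset\mathcal{G}_{n,r}$$ is an (embedded) smooth submanifold of $\mathcal{G}_{n,r}$ of dimension $r(n-s)$; that is, $\mathcal{V}_X$ with the subspace topology carries a $C^\infty$ atlas modelled on $\mathbb{R}^{r(n-s)}$ for which the inclusion $\mathcal{V}_X\hookrightarrow\mathcal{G}_{n,r}$ is a smooth embedding. -/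

import Mathlib

open scoped Manifold ContDiff

/-- The Grassmannian `G_{n,r}`: the set of all `r`-dimensional linear subspaces of `ℝⁿ`. -/
@[ext]
structure RealGrassmannian (n r : ℕ) where
  /-- the underlying linear subspace of `ℝⁿ` -/
  carrier : Submodule ℝ (Fin n → ℝ)
  finrank_carrier : Module.finrank ℝ carrier = r

namespace RealGrassmannian

/-- The model space of `G_{n,r}`: linear maps `ℝʳ → ℝⁿ⁻ʳ`, a space of dimension `r (n - r)`. -/
abbrev Model (n r : ℕ) : Type := (Fin r → ℝ) →L[ℝ] (Fin (n - r) → ℝ)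

/-- A linear splitting of `ℝⁿ` as `ℝʳ × ℝⁿ⁻ʳ`. -/
abbrev Splitting (n r : ℕ) : Type :=
  ((Fin r → ℝ) × (Fin (n - r) → ℝ)) ≃L[ℝ] (Fin n → ℝ)

variable {n r : ℕ}

/-- The injective linear map `x ↦ e (x, A x)`, parametrising the graph of `A`. -/
def graphMap (e : Splitting n r) (A : Model n r) : (Fin r → ℝ) →ₗ[ℝ] (Fin n → ℝ) :=
  (e : ((Fin r → ℝ) × (Fin (n - r) → ℝ)) →ₗ[ℝ] (Fin n → ℝ)) ∘ₗ
    LinearMap.prod LinearMap.id (A : (Fin r → ℝ) →ₗ[ℝ] (Fin (n - r) → ℝ))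

@[simp] theorem graphMap_apply (e : Splitting n r) (A : Model n r) (x : Fin r → ℝ) :
    graphMap e A x = e (x, A x) := rfl

theorem graphMap_injective (e : Splitting n r) (A : Model n r) :
    Function.Injective (graphMap e A) := by
  intro x y h
  have := e.injective h
  exact congrArg Prod.fst this

/-- The `r`-dimensional subspace `{e (x, A x) | x ∈ ℝʳ}`: the graph of `A` in the splitting `e`. -/
def graph (e : Splitting n r) (A : Model n r) : RealGrassmannian n r where
  carrier := LinearMap.range (graphMap e A)
  finrank_carrier := by
    rw [LinearMap.finrank_range_of_inj (graphMap_injective e A)]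
    simp

theorem graph_eq_iff (e e' : Splitting n r) (A B : Model n r) :
    graph e A = graph e' B ↔
      ∀ x, (e'.symm (e (x, A x))).2 = B (e'.symm (e (x, A x))).1 := by
  constructor
  · intro h x
    have hx : e (x, A x) ∈ (graph e' B).carrier := by
      rw [← h]; exact ⟨x, rfl⟩
    obtain ⟨y, hy⟩ := hx
    rw [← hy]; simp
  · intro h
    have hle : (graph e A).carrier ≤ (graph e' B).carrier := by
      rintro _ ⟨x, rfl⟩
      refine ⟨(e'.symm (e (x, A x))).1, ?_⟩
      rw [graphMap_apply, graphMap_apply, ← h x]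
      simp
    ext1
    exact Submodule.eq_of_le_of_finrank_eq hle
      ((graph e A).finrank_carrier.trans (graph e' B).finrank_carrier.symm)

theorem graph_injective (e : Splitting n r) : Function.Injective (graph e) := by
  intro A B h
  rw [graph_eq_iff] at h
  ext1 x
  simpa using h x

/-- The affine chart of `G_{n,r}` attached to a splitting `e`: it is defined on the set of all
subspaces which are graphs `{e (x, A x)}`, and sends such a subspace to the linear map `A`. -/
noncomputable def affineChart (e : Splitting n r) :
    PartialEquiv (RealGrassmannian n r) (Model n r) :=
  (Set.BijOn.toPartialEquiv (graph e) Set.univ (Set.range (graph e))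
    ⟨fun A _ => ⟨A, rfl⟩, (graph_injective e).injOn, by rintro _ ⟨A, rfl⟩; exact ⟨A, trivial, rfl⟩⟩).symm

theorem affineChart_source (e : Splitting n r) : (affineChart e).source = Set.range (graph e) := rfl

theorem affineChart_target (e : Splitting n r) : (affineChart e).target = Set.univ := rfl

theorem affineChart_symm_apply (e : Splitting n r) (A : Model n r) :
    (affineChart e).symm A = graph e A := rfl

theorem affineChart_graph (e : Splitting n r) (A : Model n r) : affineChart e (graph e A) = A :=
  (affineChart e).right_inv (Set.mem_univ A)

/-- Every subspace lies in the domain of some affine chart. -/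
theorem exists_mem_source (W : RealGrassmannian n r) :
    ∃ e : Splitting n r, W ∈ (affineChart e).source := by
  obtain ⟨C, hC⟩ := Submodule.exists_isCompl W.carrier
  have hd : Module.finrank ℝ C = n - r := by
    have := Submodule.finrank_add_eq_of_isCompl hC
    rw [W.finrank_carrier, Module.finrank_fin_fun] at this
    omega
  let a : (Fin r → ℝ) ≃ₗ[ℝ] W.carrier :=
    LinearEquiv.ofFinrankEq _ _ (by rw [W.finrank_carrier, Module.finrank_fin_fun])
  let b : (Fin (n - r) → ℝ) ≃ₗ[ℝ] C :=
    LinearEquiv.ofFinrankEq _ _ (by rw [hd, Module.finrank_fin_fun])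
  let e : Splitting n r :=
    ((a.prodCongr b).trans (Submodule.prodEquivOfIsCompl _ _ hC)).toContinuousLinearEquiv
  refine ⟨e, 0, ?_⟩
  have he : ∀ x, e (x, 0) = (a x : Fin n → ℝ) := by
    intro x; simp [e]
  ext1
  refine Submodule.eq_of_le_of_finrank_eq ?_
    ((graph e 0).finrank_carrier.trans W.finrank_carrier.symm)
  rintro _ ⟨x, rfl⟩
  rw [graphMap_apply, _root_.zero_apply, he]
  exact (a x).2

/-- First component of `x ↦ e'⁻¹ (e (x, A x))`. -/
noncomputable def coordFst (e e' : Splitting n r) (A : Model n r) :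
    (Fin r → ℝ) →L[ℝ] (Fin r → ℝ) :=
  (ContinuousLinearMap.fst ℝ (Fin r → ℝ) (Fin (n - r) → ℝ) ∘L
    e'.symm.toContinuousLinearMap ∘L e.toContinuousLinearMap) ∘L
    (ContinuousLinearMap.inl ℝ (Fin r → ℝ) (Fin (n - r) → ℝ) +
      ContinuousLinearMap.inr ℝ (Fin r → ℝ) (Fin (n - r) → ℝ) ∘L A)

/-- Second component of `x ↦ e'⁻¹ (e (x, A x))`. -/
noncomputable def coordSnd (e e' : Splitting n r) (A : Model n r) :
    (Fin r → ℝ) →L[ℝ] (Fin (n - r) → ℝ) :=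
  (ContinuousLinearMap.snd ℝ (Fin r → ℝ) (Fin (n - r) → ℝ) ∘L
    e'.symm.toContinuousLinearMap ∘L e.toContinuousLinearMap) ∘L
    (ContinuousLinearMap.inl ℝ (Fin r → ℝ) (Fin (n - r) → ℝ) +
      ContinuousLinearMap.inr ℝ (Fin r → ℝ) (Fin (n - r) → ℝ) ∘L A)

theorem coordFst_apply (e e' : Splitting n r) (A : Model n r) (x : Fin r → ℝ) :
    coordFst e e' A x = (e'.symm (e (x, A x))).1 := by
  have h : ((x, 0) + (0, A x) : (Fin r → ℝ) × (Fin (n - r) → ℝ)) = (x, A x) := by simp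
  rw [← h, map_add, map_add, Prod.fst_add]
  simp [coordFst]

theorem coordSnd_apply (e e' : Splitting n r) (A : Model n r) (x : Fin r → ℝ) :
    coordSnd e e' A x = (e'.symm (e (x, A x))).2 := by
  have h : ((x, 0) + (0, A x) : (Fin r → ℝ) × (Fin (n - r) → ℝ)) = (x, A x) := by simp
  rw [← h, map_add, map_add, Prod.snd_add]
  simp [coordSnd]

theorem contDiff_coordFst (e e' : Splitting n r) (k : ℕ∞ω) : ContDiff ℝ k (coordFst e e') := by
  unfold coordFst
  exact contDiff_const.clm_comp (contDiff_const.add (contDiff_const.clm_comp contDiff_id))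

theorem contDiff_coordSnd (e e' : Splitting n r) (k : ℕ∞ω) : ContDiff ℝ k (coordSnd e e') := by
  unfold coordSnd
  exact contDiff_const.clm_comp (contDiff_const.add (contDiff_const.clm_comp contDiff_id))

/-- The graph of `A` in `e` is a graph in `e'` iff the first component is invertible. -/
theorem graph_mem_range_iff (e e' : Splitting n r) (A : Model n r) :
    graph e A ∈ Set.range (graph e') ↔
      coordFst e e' A ∈ Set.range
        ((↑) : ((Fin r → ℝ) ≃L[ℝ] (Fin r → ℝ)) → (Fin r → ℝ) →L[ℝ] (Fin r → ℝ)) := by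
  constructor
  · rintro ⟨B, hB⟩
    have h := (graph_eq_iff e e' A B).1 hB.symm
    have hinj : Function.Injective (coordFst e e' A : (Fin r → ℝ) →ₗ[ℝ] (Fin r → ℝ)) := by
      rw [injective_iff_map_eq_zero]
      intro x hx
      have hx1 : (e'.symm (e (x, A x))).1 = 0 := by rw [← coordFst_apply]; exact hx
      have hx2 : (e'.symm (e (x, A x))).2 = 0 := by rw [h x, hx1, map_zero]
      have h0 : e'.symm (e (x, A x)) = 0 := Prod.ext hx1 hx2
      have h1 : (x, A x) = 0 := by simpa using h0
      exact congrArg Prod.fst h1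
    refine ⟨(LinearEquiv.ofInjectiveEndo _ hinj).toContinuousLinearEquiv, ?_⟩
    ext1 x
    rfl
  · rintro ⟨P, hP⟩
    refine ⟨coordSnd e e' A ∘L (P.symm : (Fin r → ℝ) →L[ℝ] (Fin r → ℝ)), ?_⟩
    rw [eq_comm, graph_eq_iff]
    intro x
    rw [← coordFst_apply, ← coordSnd_apply, ← hP]
    simp

theorem affineChart_trans_source (e e' : Splitting n r) :
    ((affineChart e).symm.trans (affineChart e')).source =
      coordFst e e' ⁻¹' Set.range
        ((↑) : ((Fin r → ℝ) ≃L[ℝ] (Fin r → ℝ)) → (Fin r → ℝ) →L[ℝ] (Fin r → ℝ)) := by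
  ext A
  rw [PartialEquiv.trans_source, PartialEquiv.symm_source, affineChart_target, Set.univ_inter,
    Set.mem_preimage, affineChart_symm_apply, affineChart_source, graph_mem_range_iff,
    Set.mem_preimage]

/-- Changes of affine charts are given by `A ↦ (c + d A) (a + b A)⁻¹`. -/
theorem affineChart_trans_apply (e e' : Splitting n r) (A : Model n r)
    (hA : A ∈ ((affineChart e).symm.trans (affineChart e')).source) :
    ((affineChart e).symm.trans (affineChart e')) A =
      coordSnd e e' A ∘L (coordFst e e' A).inverse := by
  rw [affineChart_trans_source] at hA
  obtain ⟨P, hP⟩ := hA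
  have h : graph e A = graph e' (coordSnd e e' A ∘L (coordFst e e' A).inverse) := by
    rw [graph_eq_iff]
    intro x
    rw [← coordFst_apply, ← coordSnd_apply, ← hP]
    simp
  rw [PartialEquiv.coe_trans, Function.comp_apply, affineChart_symm_apply, h, affineChart_graph]

theorem contDiffOn_affineChart_trans (e e' : Splitting n r) (k : ℕ∞ω) :
    ContDiffOn ℝ k ((affineChart e).symm.trans (affineChart e'))
      ((affineChart e).symm.trans (affineChart e')).source := by
  refine ContDiffOn.congr ?_ (fun A hA => affineChart_trans_apply e e' A hA)
  intro A hA
  rw [affineChart_trans_source] at hA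
  obtain ⟨P, hP⟩ := hA
  refine ContDiffAt.contDiffWithinAt ?_
  refine (contDiff_coordSnd e e' k).contDiffAt.clm_comp ?_
  refine ContDiffAt.comp A (g := ContinuousLinearMap.inverse) ?_
    (contDiff_coordFst e e' k).contDiffAt
  rw [← hP]
  exact contDiffAt_map_inverse P

variable (n r) in
/-- The affine charts, over all splittings of `ℝⁿ`, are compatible and cover `G_{n,r}`. -/
noncomputable def chartedSpaceCore : ChartedSpaceCore (Model n r) (RealGrassmannian n r) where
  atlas := Set.range affineChart
  chartAt W := affineChart (exists_mem_source W).choose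
  mem_chart_source W := (exists_mem_source W).choose_spec
  chart_mem_atlas W := ⟨_, rfl⟩
  open_source := by
    rintro _ _ ⟨e, rfl⟩ ⟨e', rfl⟩
    rw [affineChart_trans_source]
    exact ContinuousLinearEquiv.isOpen.preimage (contDiff_coordFst e e' 0).continuous
  continuousOn_toFun := by
    rintro _ _ ⟨e, rfl⟩ ⟨e', rfl⟩
    exact (contDiffOn_affineChart_trans e e' 0).continuousOn

/-- The topology of the Grassmann manifold. -/
noncomputable instance : TopologicalSpace (RealGrassmannian n r) :=
  (chartedSpaceCore n r).toTopologicalSpace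

/-- The atlas of affine charts of the Grassmann manifold. -/
noncomputable instance : ChartedSpace (Model n r) (RealGrassmannian n r) :=
  (chartedSpaceCore n r).toChartedSpace

/-- The Grassmannian is a smooth manifold. -/
instance (k : ℕ∞ω) : IsManifold 𝓘(ℝ, Model n r) k (RealGrassmannian n r) := by
  refine isManifold_of_contDiffOn _ _ _ ?_
  rintro f f' hf hf'
  obtain ⟨_, ⟨p, rfl⟩, hf⟩ := hf
  obtain ⟨_, ⟨⟨e, rfl⟩, rfl⟩, hf⟩ := hf
  obtain ⟨_, ⟨p', rfl⟩, hf'⟩ := hf'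
  obtain ⟨_, ⟨⟨e', rfl⟩, rfl⟩, hf'⟩ := hf'
  rw [Set.mem_singleton_iff] at hf hf'
  subst hf hf'
  have h := contDiffOn_affineChart_trans e e' k
  simp only [mfld_simps]
  exact h

end RealGrassmannian

/-- A subset `S` of a manifold `M` is an (embedded) smooth submanifold of dimension `d` if `S`, with
the subspace topology, carries a `C^∞` atlas modelled on `ℝᵈ` for which the inclusion `S → M` is a
smooth embedding. -/
def IsSmoothSubmanifold {E H M : Type*} [NormedAddCommGroup E] [NormedSpace ℝ E]
    [TopologicalSpace H] (I : ModelWithCorners ℝ E H) [TopologicalSpace M] [ChartedSpace H M]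
    (S : Set M) (d : ℕ) : Prop :=
  ∃ _ : ChartedSpace (EuclideanSpace ℝ (Fin d)) S,
    IsManifold (𝓡 d) ∞ S ∧ Manifold.IsSmoothEmbedding (𝓡 d) I ∞ (Subtype.val : S → M)

/-- The set of all row spaces `Range (F'ᵀ)` of `m × n` matrices `F'` of rank `r` with
`F' X = F X`. -/
def dataEquivalentSubspaces {m n s : ℕ} (r : ℕ) (F : Matrix (Fin m) (Fin n) ℝ)
    (X : Matrix (Fin n) (Fin s) ℝ) : Set (RealGrassmannian n r) :=
  {W | ∃ F' : Matrix (Fin m) (Fin n) ℝ,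
    F'.rank = r ∧ F' * X = F * X ∧ W.carrier = LinearMap.range F'.transpose.mulVecLin}

/-! Write `f` for `Xᵀ`, which is onto `ℝˢ`, and `U` for the row space of `F X`, of dimension `r`.
Membership in the set depends only on images under `f`: it says `f(W) = U`
(`mem_dataEquivalentSubspaces_iff`). Fix one such `W₀` and a complement `D` of `U`. Each such `W` is
mapped isomorphically onto `U`, so it meets `f⁻¹(D)` trivially. Hence a single affine chart, that of
the splitting `ℝⁿ = W₀ ⊕ f⁻¹(D)`, contains the whole set. The graph of `A : W₀ → f⁻¹(D)` has image
`U` iff the values of `f ∘ A` lie in `U ∩ D = 0`, so in this chart the set is the linear space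
`Hom(W₀, ker f)`, of dimension `r (n - s)` (`exists_setOf_map_eq_graph_image`). A linear subspace
seen in a chart is a submanifold (`isSmoothSubmanifold_symm_image`). -/

/-- In a chart onto the whole model space, the preimage of a linear subspace is a smooth
submanifold. -/
theorem isSmoothSubmanifold_symm_image {E M : Type*} [NormedAddCommGroup E] [NormedSpace ℝ E]
    [FiniteDimensional ℝ E] [TopologicalSpace M] [ChartedSpace E M]
    (ψ : OpenPartialHomeomorph M E) (hψ : ψ ∈ IsManifold.maximalAtlas 𝓘(ℝ, E) ∞ M)
    (hψt : ψ.target = Set.univ) (V : Submodule ℝ E) {d : ℕ} (hd : Module.finrank ℝ V = d) :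
    IsSmoothSubmanifold 𝓘(ℝ, E) (ψ.symm '' (V : Set E)) d := by
  have hmem (v : E) : v ∈ ψ.target := hψt ▸ Set.mem_univ v
  have hS : ψ.symm '' (V : Set E) ⊆ ψ.source := by
    rintro _ ⟨v, -, rfl⟩
    exact ψ.map_target (hmem v)
  have hcont : Continuous ψ.symm :=
    continuousOn_univ.1 (hψt ▸ ψ.symm.continuousOn)
  let Φ : ↥(ψ.symm '' (V : Set E)) ≃ₜ V :=
    { toFun x := ⟨ψ x, by
        obtain ⟨_, v, hv, rfl⟩ := x
        rw [ψ.right_inv (hmem v)]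
        exact hv⟩
      invFun v := ⟨ψ.symm v, v, v.2, rfl⟩
      left_inv x := Subtype.ext (ψ.left_inv (hS x.2))
      right_inv v := Subtype.ext (ψ.right_inv (hmem v))
      continuous_toFun := continuous_induced_rng.2
        (ψ.continuousOn.comp_continuous continuous_subtype_val fun x => hS x.2)
      continuous_invFun := continuous_induced_rng.2 (hcont.comp continuous_subtype_val) }
  let ℓ : V ≃L[ℝ] EuclideanSpace ℝ (Fin d) :=
    ContinuousLinearEquiv.ofFinrankEq (by simp [hd])
  let φ := (Φ.trans ℓ.toHomeomorph).toOpenPartialHomeomorph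
  -- `K` supplies the normal directions: in the charts `φ` and `ψ`, with `E` split as `V ⊕ K`, the
  -- inclusion becomes `u ↦ (u, 0)`.
  obtain ⟨K, hK⟩ := Submodule.exists_isCompl V
  let equiv : (EuclideanSpace ℝ (Fin d) × K) ≃L[ℝ] E :=
    ((ℓ.symm.toLinearEquiv.prodCongr (LinearEquiv.refl ℝ K)).trans
      (Submodule.prodEquivOfIsCompl V K hK)).toContinuousLinearEquiv
  let := φ.singletonChartedSpace rfl
  have : IsManifold (𝓡 d) ∞ ↥(ψ.symm '' (V : Set E)) := φ.isManifold_singleton rfl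
  refine ⟨inferInstance, inferInstance, ?_, Topology.IsEmbedding.subtypeVal⟩
  refine Manifold.IsImmersionOfComplement.isImmersion (F := K) fun x => ?_
  refine Manifold.IsImmersionAtOfComplement.mk_of_charts equiv φ ψ (Set.mem_univ x) (hS x.2)
    (IsManifold.subset_maximalAtlas (Set.mem_singleton φ)) hψ (fun y _ => hS y.2) ?_
  intro u _
  have h1 : equiv (u, 0) = (ℓ.symm u : E) := by simp [equiv]
  have h2 : ψ (ψ.symm (ℓ.symm u : E)) = (ℓ.symm u : E) := ψ.right_inv (hmem _)
  rw [Function.comp_apply (f := equiv), h1]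
  exact h2

/-! ### Graphs in a splitting, and subspaces with a prescribed image -/

namespace RealGrassmannian

variable {n r : ℕ}

theorem isSmoothSubmanifold_graph_image (e : Splitting n r) (V : Submodule ℝ (Model n r)) {d : ℕ}
    (hd : Module.finrank ℝ V = d) :
    IsSmoothSubmanifold 𝓘(ℝ, Model n r) (graph e '' (V : Set (Model n r))) d := by
  have hmem : affineChart e ∈ (chartedSpaceCore n r).atlas := ⟨e, rfl⟩
  refine isSmoothSubmanifold_symm_image
    ((chartedSpaceCore n r).openPartialHomeomorph (affineChart e) hmem)
    (IsManifold.subset_maximalAtlas ?_) rfl V hd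
  exact Set.mem_iUnion₂.2 ⟨affineChart e, hmem, rfl⟩

/-- Complementary subspaces of dimensions `r` and `n - r` are the factors of a splitting. -/
theorem exists_splitting_of_isCompl (W : RealGrassmannian n r) {C : Submodule ℝ (Fin n → ℝ)}
    (hC : IsCompl W.carrier C) :
    ∃ e : Splitting n r, graph e 0 = W ∧ (∀ y, e (0, y) ∈ C) ∧ ∀ c ∈ C, (e.symm c).1 = 0 := by
  have hd : Module.finrank ℝ C = n - r := by
    have := Submodule.finrank_add_eq_of_isCompl hC
    rw [W.finrank_carrier, Module.finrank_fin_fun] at this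
    omega
  let a : (Fin r → ℝ) ≃ₗ[ℝ] W.carrier :=
    LinearEquiv.ofFinrankEq _ _ (by rw [W.finrank_carrier, Module.finrank_fin_fun])
  let b : (Fin (n - r) → ℝ) ≃ₗ[ℝ] C :=
    LinearEquiv.ofFinrankEq _ _ (by rw [hd, Module.finrank_fin_fun])
  let e : Splitting n r :=
    ((a.prodCongr b).trans (Submodule.prodEquivOfIsCompl _ _ hC)).toContinuousLinearEquiv
  have he₁ (x) : e (x, 0) = (a x : Fin n → ℝ) := by simp [e]
  have he₂ (y) : e (0, y) = (b y : Fin n → ℝ) := by simp [e]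
  refine ⟨e, ?_, fun y => he₂ y ▸ (b y).2, fun c hc => ?_⟩
  · ext1
    refine Submodule.eq_of_le_of_finrank_eq ?_
      ((graph e 0).finrank_carrier.trans W.finrank_carrier.symm)
    rintro _ ⟨x, rfl⟩
    rw [graphMap_apply, _root_.zero_apply, he₁]
    exact (a x).2
  · have h : e (0, b.symm ⟨c, hc⟩) = c := by simp [he₂]
    rw [← h, ContinuousLinearEquiv.symm_apply_apply]

/-- A subspace meeting the second factor of a splitting trivially is a graph. -/
theorem mem_range_graph (e : Splitting n r) (W : RealGrassmannian n r)
    (h : ∀ w ∈ W.carrier, (e.symm w).1 = 0 → w = 0) : W ∈ Set.range (graph e) := by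
  let q : W.carrier →ₗ[ℝ] (Fin r → ℝ) × (Fin (n - r) → ℝ) :=
    e.symm.toLinearEquiv.toLinearMap ∘ₗ W.carrier.subtype
  let p : W.carrier →ₗ[ℝ] (Fin r → ℝ) := LinearMap.fst ℝ _ _ ∘ₗ q
  have hp : Function.Injective p := by
    rw [injective_iff_map_eq_zero]
    exact fun w hw => Subtype.ext (h w w.2 hw)
  let P : W.carrier ≃ₗ[ℝ] (Fin r → ℝ) :=
    LinearEquiv.ofInjectiveOfFinrankEq p hp (by rw [W.finrank_carrier, Module.finrank_fin_fun])
  refine ⟨LinearMap.toContinuousLinearMap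
    (LinearMap.snd ℝ _ _ ∘ₗ q ∘ₗ P.symm.toLinearMap), ?_⟩
  ext1
  refine Submodule.eq_of_le_of_finrank_eq ?_
    ((graph e _).finrank_carrier.trans W.finrank_carrier.symm)
  rintro _ ⟨x, rfl⟩
  have hx : (x, (q (P.symm x)).2) = q (P.symm x) :=
    Prod.ext (P.apply_symm_apply x).symm rfl
  have hq (w : W.carrier) : e (q w) = w := e.apply_symm_apply _
  rw [graphMap_apply]
  change e (x, (q (P.symm x)).2) ∈ _
  rw [hx, hq]
  exact (P.symm x).2

/-- The linear maps whose graph differs from the first factor of the splitting `e` only by vectors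
of `K`. -/
def modelsInto (e : Splitting n r) (K : Submodule ℝ (Fin n → ℝ)) : Submodule ℝ (Model n r) where
  carrier := {A | ∀ x, e (0, A x) ∈ K}
  zero_mem' x := by
    rw [_root_.zero_apply, ← Prod.zero_eq_mk, map_zero]
    exact K.zero_mem
  add_mem' {A B} hA hB x := by
    have : ((0, (A + B) x) : (Fin r → ℝ) × (Fin (n - r) → ℝ)) = (0, A x) + (0, B x) := by simp
    rw [this, map_add]
    exact K.add_mem (hA x) (hB x)
  smul_mem' c A hA x := by
    have : ((0, (c • A) x) : (Fin r → ℝ) × (Fin (n - r) → ℝ)) = c • (0, A x) := by simp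
    rw [this, map_smul]
    exact K.smul_mem c (hA x)

theorem mem_modelsInto {e : Splitting n r} {K : Submodule ℝ (Fin n → ℝ)} {A : Model n r} :
    A ∈ modelsInto e K ↔ ∀ x, e (0, A x) ∈ K := Iff.rfl

/-- Since `K` lies in the second factor of `e`, composing with `y ↦ e (0, y)` identifies these maps
with `Hom(ℝʳ, K)`. -/
theorem finrank_modelsInto (e : Splitting n r) (K : Submodule ℝ (Fin n → ℝ))
    (hK : ∀ k ∈ K, (e.symm k).1 = 0) :
    Module.finrank ℝ (modelsInto e K) = r * Module.finrank ℝ K := by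
  have hinv (k) (hk : k ∈ K) : e (0, (e.symm k).2) = k := by
    rw [← hK k hk, Prod.mk.eta, e.apply_symm_apply]
  let j : (Fin (n - r) → ℝ) →ₗ[ℝ] (Fin n → ℝ) :=
    e.toLinearEquiv.toLinearMap ∘ₗ LinearMap.inr ℝ _ _
  let i : (Fin n → ℝ) →ₗ[ℝ] (Fin (n - r) → ℝ) :=
    LinearMap.snd ℝ _ _ ∘ₗ e.symm.toLinearEquiv.toLinearMap
  let E : modelsInto e K ≃ₗ[ℝ] ((Fin r → ℝ) →ₗ[ℝ] K) :=
    { toFun A := LinearMap.codRestrict K (j ∘ₗ (A : Model n r).toLinearMap) A.2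
      map_add' A B := LinearMap.ext fun x => Subtype.ext (map_add j _ _)
      map_smul' c A := LinearMap.ext fun x => Subtype.ext (map_smul j _ _)
      invFun B := ⟨LinearMap.toContinuousLinearMap (i ∘ₗ K.subtype ∘ₗ B), fun x => by
        change e (0, (e.symm (B x)).2) ∈ K
        rw [hinv _ (B x).2]
        exact (B x).2⟩
      left_inv A := by
        ext1
        ext1 x
        change (e.symm (e (0, (A : Model n r) x))).2 = _
        rw [e.symm_apply_apply]
      right_inv B := LinearMap.ext fun x => Subtype.ext (hinv _ (B x).2) }
  rw [E.finrank_eq, Module.finrank_linearMap, Module.finrank_fin_fun]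

/-- The `r`-dimensional subspaces with prescribed `r`-dimensional image under a surjective linear
map are, in a suitable splitting, the graphs of a linear space of maps. -/
theorem exists_setOf_map_eq_graph_image {s : ℕ} {f : (Fin n → ℝ) →ₗ[ℝ] (Fin s → ℝ)}
    (hf : Function.Surjective f) (W₀ : RealGrassmannian n r)
    (h₀ : Module.finrank ℝ (W₀.carrier.map f) = r) :
    ∃ (e : Splitting n r) (V : Submodule ℝ (Model n r)), Module.finrank ℝ V = r * (n - s) ∧
      {W : RealGrassmannian n r | W.carrier.map f = W₀.carrier.map f} = graph e '' V := by
  obtain ⟨D, hD⟩ := Submodule.exists_isCompl (W₀.carrier.map f)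
  -- `W` and its image both have dimension `r`, so `f` is injective on `W`.
  have hinj (W : RealGrassmannian n r) (hW : W.carrier.map f = W₀.carrier.map f) :
      ∀ w ∈ W.carrier, f w = 0 → w = 0 := by
    have hfin : Module.finrank ℝ (LinearMap.range (f.domRestrict W.carrier)) =
        Module.finrank ℝ W.carrier := by
      rw [LinearMap.range_domRestrict, hW, h₀, W.finrank_carrier]
    have hk := LinearMap.finrank_range_add_finrank_ker (f.domRestrict W.carrier)
    have hker : LinearMap.ker (f.domRestrict W.carrier) = ⊥ :=
      Submodule.finrank_eq_zero.1 (by omega)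
    intro w hw hfw
    have : (⟨w, hw⟩ : W.carrier) ∈ LinearMap.ker (f.domRestrict W.carrier) := hfw
    rw [hker, Submodule.mem_bot] at this
    exact congrArg Subtype.val this
  -- Stated for every `W` with the prescribed image, not just `W₀`: this is why one chart suffices.
  have hdisj (W : RealGrassmannian n r) (hW : W.carrier.map f = W₀.carrier.map f)
      (w : Fin n → ℝ) (hw : w ∈ W.carrier) (hwD : f w ∈ D) : w = 0 :=
    hinj W hW w hw (Submodule.disjoint_def.1 hD.disjoint _ (hW ▸ Submodule.mem_map_of_mem hw) hwD)
  have hcompl : IsCompl W₀.carrier (D.comap f) := by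
    refine ⟨Submodule.disjoint_def.2 fun w hw hwD => hdisj W₀ rfl w hw hwD, ?_⟩
    rw [codisjoint_iff, eq_top_iff]
    intro x _
    have hx : f x ∈ W₀.carrier.map f ⊔ D := hD.sup_eq_top ▸ Submodule.mem_top
    obtain ⟨_, ⟨w, hw, rfl⟩, d, hd, hwd⟩ := Submodule.mem_sup.1 hx
    refine Submodule.mem_sup.2 ⟨w, hw, x - w, ?_, add_sub_cancel _ _⟩
    rw [Submodule.mem_comap, map_sub, ← hwd, add_sub_cancel_left]
    exact hd
  obtain ⟨e, hgraph, heC, hCe⟩ := exists_splitting_of_isCompl W₀ hcompl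
  have hker : LinearMap.ker f ≤ D.comap f := fun x hx => by
    rw [Submodule.mem_comap, LinearMap.mem_ker.1 hx]
    exact D.zero_mem
  have hsum (A : Model n r) (x) : e (x, A x) = e (x, 0) + e (0, A x) := by
    rw [← map_add]; simp
  have hW₀ : W₀.carrier = LinearMap.range (graphMap e 0) := by rw [← hgraph]; rfl
  have he₀ (x) : e (x, 0) ∈ W₀.carrier := by rw [hW₀]; exact ⟨x, rfl⟩
  refine ⟨e, modelsInto e (LinearMap.ker f), ?_, Set.ext fun W => ⟨fun hW => ?_, ?_⟩⟩
  · have := LinearMap.finrank_range_add_finrank_ker f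
    rw [LinearMap.range_eq_top.2 hf, finrank_top, Module.finrank_fin_fun,
      Module.finrank_fin_fun] at this
    rw [finrank_modelsInto e _ fun k hk => hCe k (hker hk), Nat.eq_sub_of_add_eq' this]
  -- A vector of `W` with zero first coordinate lies in `f⁻¹(D)`, hence vanishes.
  · obtain ⟨A, rfl⟩ := mem_range_graph e W fun w hw hw0 => by
      refine hdisj W hW w hw ?_
      have := heC (e.symm w).2
      rwa [← hw0, Prod.mk.eta, e.apply_symm_apply] at this
    refine ⟨A, fun x => ?_, rfl⟩
    -- `f (e (0, A x))` lies in `D` by the choice of splitting, and in the image of `W₀` as a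
    -- difference of two elements of it.
    refine Submodule.disjoint_def.1 hD.disjoint _ ?_ (heC (A x))
    have h₁ : f (e (x, A x)) ∈ W₀.carrier.map f := by
      rw [← hW]
      exact Submodule.mem_map_of_mem ⟨x, rfl⟩
    rw [hsum, map_add] at h₁
    exact (Submodule.add_mem_iff_right _ (Submodule.mem_map_of_mem (he₀ x))).1 h₁
  · rintro ⟨A, hA, rfl⟩
    have hcomp : f ∘ₗ graphMap e A = f ∘ₗ graphMap e 0 := by
      refine LinearMap.ext fun x => ?_
      have hx : f (e (0, A x)) = 0 := hA x
      rw [LinearMap.comp_apply, LinearMap.comp_apply, graphMap_apply, graphMap_apply, hsum,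
        map_add, hx, add_zero, _root_.zero_apply]
    change (LinearMap.range (graphMap e A)).map f = W₀.carrier.map f
    rw [hW₀, ← LinearMap.range_comp, ← LinearMap.range_comp, hcomp]

end RealGrassmannian

/-! ### Row spaces of matrices -/

/-- If `rank (F X) = r`, then `W` is a row space of a rank `r` matrix `F'` with `F' X = F X` iff
`Xᵀ` maps `W` onto the row space of `F X`. -/
theorem mem_dataEquivalentSubspaces_iff {m n s r : ℕ} {F : Matrix (Fin m) (Fin n) ℝ}
    {X : Matrix (Fin n) (Fin s) ℝ} (hFX : (F * X).rank = r) (W : RealGrassmannian n r) :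
    W ∈ dataEquivalentSubspaces r F X ↔
      W.carrier.map X.transpose.mulVecLin = LinearMap.range (F * X).transpose.mulVecLin := by
  constructor
  · rintro ⟨F', -, hF', hW⟩
    rw [hW, ← LinearMap.range_comp, ← Matrix.mulVecLin_mul, ← Matrix.transpose_mul, hF']
  · intro hW
    -- Each row of `F X` lifts through `Xᵀ` to a vector of `W`; these lifts are the rows of the
    -- required matrix.
    have hrow (i : Fin m) : ∃ w ∈ W.carrier, X.transpose.mulVecLin w = (F * X).row i := by
      rw [← Submodule.mem_map, hW, Matrix.range_mulVecLin]
      exact Submodule.subset_span ⟨i, rfl⟩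
    choose w hwW hwX using hrow
    have hX : Matrix.of w * X = F * X := by
      ext i j
      have := congrFun (hwX i) j
      rw [Matrix.mulVecLin_apply, Matrix.mulVec_transpose] at this
      exact this
    have hle : LinearMap.range (Matrix.of w).transpose.mulVecLin ≤ W.carrier := by
      rw [Matrix.range_mulVecLin, Submodule.span_le]
      rintro _ ⟨i, rfl⟩
      exact hwW i
    have hrank : Module.finrank ℝ (LinearMap.range (Matrix.of w).transpose.mulVecLin) =
        (Matrix.of w).rank := Matrix.rank_transpose (Matrix.of w)
    -- The product with `X` already has rank `r`, so the rows span all of `W`.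
    have h₁ : r ≤ (Matrix.of w).rank := by
      rw [← hFX, ← hX]
      exact Matrix.rank_mul_le_left _ _
    have heq := Submodule.eq_of_le_of_finrank_le hle (by rw [W.finrank_carrier, hrank]; exact h₁)
    exact ⟨Matrix.of w, by rw [← hrank, heq, W.finrank_carrier], hX, heq.symm⟩

theorem mainTheorem3 (m n s r : ℕ) (F : Matrix (Fin m) (Fin n) ℝ) (X : Matrix (Fin n) (Fin s) ℝ)
    (hF : F.rank = r) (hrs : r ≤ s) (hsn : s ≤ n) (hX : LinearIndependent ℝ X.col)
    (hFX : (F * X).rank = r) :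
    IsSmoothSubmanifold 𝓘(ℝ, RealGrassmannian.Model n r) (dataEquivalentSubspaces r F X)
      (r * (n - s)) := by
  let W₀ : RealGrassmannian n r :=
    ⟨LinearMap.range F.transpose.mulVecLin, (Matrix.rank_transpose F).trans hF⟩
  have h₀ : W₀.carrier.map X.transpose.mulVecLin =
      LinearMap.range (F * X).transpose.mulVecLin :=
    (mem_dataEquivalentSubspaces_iff hFX W₀).1 ⟨F, hF, rfl, rfl⟩
  -- Independent columns give `X`, hence `Xᵀ`, rank `s`.
  have hsurj : Function.Surjective X.transpose.mulVecLin := by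
    rw [← LinearMap.range_eq_top]
    refine Submodule.eq_top_of_finrank_eq ?_
    have h := Matrix.rank_transpose X
    rw [Matrix.rank_eq_finrank_span_cols X, finrank_span_eq_card hX, Fintype.card_fin] at h
    rw [Module.finrank_fin_fun]
    exact h
  obtain ⟨e, V, hV, hset⟩ := RealGrassmannian.exists_setOf_map_eq_graph_image hsurj W₀ (by
    rw [h₀]
    exact (Matrix.rank_transpose (F * X)).trans hFX)
  have hS : dataEquivalentSubspaces r F X = RealGrassmannian.graph e '' V := by
    rw [← hset]
    ext W
    rw [mem_dataEquivalentSubspaces_iff hFX, Set.mem_ofPred_eq, h₀]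
  rw [hS]
  exact RealGrassmannian.isSmoothSubmanifold_graph_image e V hV
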